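/- Let $\mathbb K$ be a field. A (multiplicative) Hom-Lie algebra $(L,\alpha_L)$ is a $\mathbb K$-vector space $L$ with a bilinear alternating bracket ($[x,x]=0$, hence $[x,y]=-[y,x]$) and a linear map $\alpha_L:L\to L$ such that $\alpha_L[x,y]=[\alpha_L(x),\alpha_L(y)]$ and $[\alpha_L(x),[y,z]]+[\alpha_L(z),[x,y]]+[\alpha_L(y),[z,x]]=0$. Homomorphisms are the linear maps that preserve brackets and commute with the maps $\alpha$. $L$ is perfect if it is spanned by its brackets. A central extension of $L$ is a surjective homomorphism $\pi:E\to L$ with $[\operatorname{Ker}\pi,E]=0$; it is universal if for every central extension $\pi':E'\to L$ there is a unique homomorphism $h:E\to E'$ with $\pi'\circ h=\pi$. For a Hom-Lie algebra $(M,\alpha_M)$, the non-abelian tensor product $M\star M$ (for the actions ${}^{x}y=[x,y]$ of $M$ on itself) is the quotient of $M\otimes M$ by the subspace spanned by all 1. $[m,m']\otimes\alpha_M(n)-\alpha_M(m)\otimes[m',n]+\alpha_M(m')\otimes[m,n]$, 2. $\alpha_M(m)\otimes[n,n']-[n',m]\otimes\alpha_M(n)+[n,m]\otimes\alpha_M(n')$,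 3. $[n,m]\otimes[m,n]$, 4. $[n,m]\otimes[m',n']+[n',m']\otimes[m,n]$, 5. $[[n,m],[n',m']]\otimes\alpha_M[m'',n'']+[[n',m'],[n'',m'']]\otimes\alpha_M[m,n]+[[n'',m''],[n,m]]\otimes\alpha_M[m',n']$. Writing $m\star n$ for the class of $m\otimes n$, it is a Hom-Lie algebra with $[m\star n,m'\star n']=-[n,m]\star[m',n']$ and $\alpha_{M\star M}(m\star n)=\alpha_M(m)\star\alpha_M(n)$. There is a homomorphism $\psi_M:M\star M\to M$, $m\star n\mapsto[m,n]$, and a homomorphism $f:M\to M'$ induces a homomorphism $f\star f:M\star M\to M'\star M'$, $m\star n\mapsto f(m)\star f(n)$. **Theorem.** Let $(G,\alpha_G)$ be a perfect Hom-Lie algebra with $\alpha_G$ surjective. Then $\psi_G:G\star G\to G$ and $\psi_{G\star G}:(G\star G)\star(G\star G)\to G\star G$ are universal central extensions. Moreover, for every universal central extension $p:\mathfrak{uce}(G)\to G$ of $G$ and every universal central extension $q:\mathfrak{uce}(G\star G)\to G\star G$ of $G\star G$, there is a surjective homomorphism of Hom-Lie algebras $$\omega:\mathfrak{uce}(G\star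 G)\twoheadrightarrow\mathfrak{uce}(G)\star\mathfrak{uce}(G)$$ such that $(p\star p)\circ\omega=q$. -/

import Mathlib

open scoped TensorProduct

universe u v w

/-- A (multiplicative) Hom-Lie algebra structure on a `K`-vector space `L`. The bracket is required
to be alternating; this is the same as skew-symmetry (see `HomLieAlgebra.skew`) unless
`K` has characteristic two. -/
class HomLieAlgebra (K : Type v) (L : Type u) [Field K] [AddCommGroup L] [Module K L] where
  /-- the bracket -/
  bracket : L →ₗ[K] L →ₗ[K] L
  /-- the twisting map -/
  alpha : L →ₗ[K] L
  bracket_self : ∀ x, bracket x x = 0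
  hom_jacobi : ∀ x y z, bracket (alpha x) (bracket y z) + bracket (alpha z) (bracket x y)
    + bracket (alpha y) (bracket z x) = 0
  alpha_bracket : ∀ x y, alpha (bracket x y) = bracket (alpha x) (alpha y)

namespace HomLieAlgebra

section Basic

variable (K : Type v) [Field K] {L : Type u} [AddCommGroup L] [Module K L] [HomLieAlgebra K L]

/-- `br K x y` is the bracket `[x, y]`. -/
abbrev br (x y : L) : L := bracket (K := K) x y

/-- `tw K x` is `α_L(x)`. -/
abbrev tw (x : L) : L := alpha (K := K) x

theorem skew (x y : L) : br K x y = - br K y x := by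
  have h := bracket_self (K := K) (x + y)
  simp only [map_add, LinearMap.add_apply, bracket_self, zero_add, add_zero] at h
  exact eq_neg_of_add_eq_zero_right h

/-- The Hom-Jacobi identity with the double brackets on the left. -/
theorem jacobi' (x y z : L) : br K (br K x y) (tw K z) + br K (br K y z) (tw K x)
    + br K (br K z x) (tw K y) = 0 := by
  have h := hom_jacobi (K := K) x y z
  rw [skew K (br K x y), skew K (br K y z), skew K (br K z x), ← neg_add, ← neg_add, neg_eq_zero,
    ← h]
  abel

/-- A Hom-Lie algebra `L` is perfect if `L = [L, L]`, the span of all brackets. -/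
def IsPerfect (K : Type v) [Field K] (L : Type u) [AddCommGroup L] [Module K L]
    [HomLieAlgebra K L] : Prop :=
  Submodule.span K {z : L | ∃ x y : L, z = br K x y} = ⊤

end Basic

end HomLieAlgebra

open HomLieAlgebra

/-- Homomorphisms of Hom-Lie algebras. -/
structure HomLieHom (K : Type v) [Field K] (L : Type u) (L' : Type w)
    [AddCommGroup L] [Module K L] [HomLieAlgebra K L]
    [AddCommGroup L'] [Module K L'] [HomLieAlgebra K L'] extends L →ₗ[K] L' where
  map_bracket' : ∀ x y : L, toFun (br K x y) = br K (toFun x) (toFun y)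
  map_alpha' : ∀ x : L, toFun (tw K x) = tw K (toFun x)

namespace HomLieHom

section Basic

variable {K : Type v} [Field K] {L : Type u} {L' : Type w}
  [AddCommGroup L] [Module K L] [HomLieAlgebra K L]
  [AddCommGroup L'] [Module K L'] [HomLieAlgebra K L']

instance : CoeFun (HomLieHom K L L') (fun _ => L → L') := ⟨fun f => f.toLinearMap⟩

theorem map_br (f : HomLieHom K L L') (x y : L) : f (br K x y) = br K (f x) (f y) :=
  f.map_bracket' x y

theorem map_tw (f : HomLieHom K L L') (x : L) : f (tw K x) = tw K (f x) :=
  f.map_alpha' x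

end Basic

section Central

variable {K : Type v} [Field K] {E : Type*} {L : Type*}
  [AddCommGroup E] [Module K E] [HomLieAlgebra K E]
  [AddCommGroup L] [Module K L] [HomLieAlgebra K L]

/-- `π : E → L` is a central extension of `L`: it is surjective and `[Ker π, E] = 0`. -/
def IsCentralExtension (π : HomLieHom K E L) : Prop :=
  Function.Surjective π ∧ ∀ x : E, π x = 0 → ∀ y : E, br K x y = 0

end Central

/-- `π : E → L` is a universal central extension of `L`, where the universal property is tested on
central extensions of `L` that live in `Type w`. -/
def IsUniversalCentralExtension.{w', v', u₁, u₂} {K : Type v'} [Field K] {E : Type u₁} {L : Type u₂}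
    [AddCommGroup E] [Module K E] [HomLieAlgebra K E]
    [AddCommGroup L] [Module K L] [HomLieAlgebra K L] (π : HomLieHom K E L) : Prop :=
  IsCentralExtension π ∧
    ∀ (E' : Type w') [AddCommGroup E'] [Module K E'] [HomLieAlgebra K E']
      (π' : HomLieHom K E' L), IsCentralExtension π' →
        ∃! h : HomLieHom K E E', ∀ x : E, π' (h x) = π x

end HomLieHom

/-- A Hom-action of `L` on `M`; `act x m` is `ˣm`. -/
structure HomAction (K : Type v) [Field K] (L : Type u) (M : Type w)
    [AddCommGroup L] [Module K L] [HomLieAlgebra K L]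
    [AddCommGroup M] [Module K M] [HomLieAlgebra K M] where
  act : L →ₗ[K] M →ₗ[K] M
  act_bracket : ∀ (x y : L) (m : M),
    act (br K x y) (tw K m) = act (tw K x) (act y m) - act (tw K y) (act x m)
  bracket_act : ∀ (x : L) (m m' : M),
    act (tw K x) (br K m m') = br K (act x m) (tw K m') + br K (tw K m) (act x m')
  alpha_act : ∀ (x : L) (m : M), tw K (act x m) = act (tw K x) (tw K m)

/-- Compatible mutual Hom-actions of `M` and `N` on each other: `onN.act m n` is `ᵐn` and
`onM.act n m` is `ⁿm`. -/
structure CompatibleActions (K : Type v) [Field K] (M : Type u) (N : Type w)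
    [AddCommGroup M] [Module K M] [HomLieAlgebra K M]
    [AddCommGroup N] [Module K N] [HomLieAlgebra K N] where
  onN : HomAction K M N
  onM : HomAction K N M
  compat_M : ∀ (m m' : M) (n : N), onM.act (onN.act m n) m' = br K m' (onM.act n m)
  compat_N : ∀ (m : M) (n n' : N), onN.act (onM.act n m) n' = br K n' (onN.act m n)

/-- The Hom-action of a Hom-Lie algebra on itself by its bracket. -/
def HomAction.adjoint (K : Type v) [Field K] (M : Type u)
    [AddCommGroup M] [Module K M] [HomLieAlgebra K M] : HomAction K M M where
  act := bracket (K := K)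
  act_bracket x y m := by
    have h := jacobi' K x y m
    have h1 := skew K (tw K x) (br K y m)
    have h2 := skew K (tw K y) (br K x m)
    have h3 : br K (br K m x) (tw K y) = - br K (br K x m) (tw K y) := by
      rw [skew K m x]; simp [br]
    rw [h3] at h
    change br K (br K x y) (tw K m) = br K (tw K x) (br K y m) - br K (tw K y) (br K x m)
    rw [h1, h2, ← sub_eq_zero, ← h]
    abel
  bracket_act x m m' := by
    have h := jacobi' K x m m'
    have h1 := skew K (tw K x) (br K m m')
    have h2 := skew K (tw K m) (br K x m')
    have h3 : br K (br K m' x) (tw K m) = - br K (br K x m') (tw K m) := by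
      rw [skew K m' x]; simp [br]
    rw [h3] at h
    change br K (tw K x) (br K m m') = br K (br K x m) (tw K m') + br K (tw K m) (br K x m')
    rw [h1, h2, eq_comm, ← sub_eq_zero, ← h]
    abel
  alpha_act x m := alpha_bracket x m

/-- The compatible mutual Hom-actions of a Hom-Lie algebra on itself by its bracket. -/
def CompatibleActions.adjoint (K : Type v) [Field K] (M : Type u)
    [AddCommGroup M] [Module K M] [HomLieAlgebra K M] : CompatibleActions K M M where
  onN := HomAction.adjoint K M
  onM := HomAction.adjoint K M
  compat_M m m' n := by
    change br K (br K m n) m' = br K m' (br K n m)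
    rw [skew K (br K m n) m', skew K m n]; simp [br]
  compat_N m n n' := by
    change br K (br K n m) n' = br K n' (br K m n)
    rw [skew K (br K n m) n', skew K n m]; simp [br]

section TensorDef

variable {K : Type v} [Field K] {M : Type u} {N : Type w}
  [AddCommGroup M] [Module K M] [HomLieAlgebra K M]
  [AddCommGroup N] [Module K N] [HomLieAlgebra K N]

/-- The elements of `M ⊗ N` that are killed in the non-abelian tensor product. -/
inductive CompatibleActions.Relator (A : CompatibleActions K M N) : M ⊗[K] N → Prop
  | bracket_left (m m' : M) (n : N) : A.Relator
      (br K m m' ⊗ₜ tw K n - tw K m ⊗ₜ A.onN.act m' n + tw K m' ⊗ₜ A.onN.act m n)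
  | bracket_right (m : M) (n n' : N) : A.Relator
      (tw K m ⊗ₜ br K n n' - A.onM.act n' m ⊗ₜ tw K n + A.onM.act n m ⊗ₜ tw K n')
  | diag (m : M) (n : N) : A.Relator (A.onM.act n m ⊗ₜ A.onN.act m n)
  | swap (m m' : M) (n n' : N) : A.Relator
      (A.onM.act n m ⊗ₜ A.onN.act m' n' + A.onM.act n' m' ⊗ₜ A.onN.act m n)
  | cyclic (m m' m'' : M) (n n' n'' : N) : A.Relator
      (br K (A.onM.act n m) (A.onM.act n' m') ⊗ₜ tw K (A.onN.act m'' n'')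
        + br K (A.onM.act n' m') (A.onM.act n'' m'') ⊗ₜ tw K (A.onN.act m n)
        + br K (A.onM.act n'' m'') (A.onM.act n m) ⊗ₜ tw K (A.onN.act m' n'))

/-- The subspace of `M ⊗ N` spanned by the relators. -/
def CompatibleActions.relations (A : CompatibleActions K M N) : Submodule K (M ⊗[K] N) :=
  Submodule.span K {t | A.Relator t}

/-- The non-abelian tensor product `M ⋆ N`, as a vector space. -/
def NonabTensor (A : CompatibleActions K M N) : Type (max u w) := (M ⊗[K] N) ⧸ A.relations

noncomputable instance (A : CompatibleActions K M N) : AddCommGroup (NonabTensor A) :=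
  inferInstanceAs (AddCommGroup ((M ⊗[K] N) ⧸ A.relations))

noncomputable instance (A : CompatibleActions K M N) : Module K (NonabTensor A) :=
  inferInstanceAs (Module K ((M ⊗[K] N) ⧸ A.relations))

namespace NonabTensor

variable (A : CompatibleActions K M N)

/-- The quotient map `M ⊗ N → M ⋆ N`. -/
noncomputable def mk : M ⊗[K] N →ₗ[K] NonabTensor A := A.relations.mkQ

/-- The class `m ⋆ n` of `m ⊗ n`. -/
noncomputable def star (m : M) (n : N) : NonabTensor A := mk A (m ⊗ₜ n)

theorem mk_surjective : Function.Surjective (mk A) := A.relations.mkQ_surjective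

theorem mk_relator {t : M ⊗[K] N} (h : A.Relator t) : mk A t = 0 :=
  (Submodule.Quotient.mk_eq_zero _).2 (Submodule.subset_span h)

/-- A linear map on `M ⊗ N` that kills the relators descends to `M ⋆ N`. -/
noncomputable def descend {P : Type*} [AddCommGroup P] [Module K P] (f : M ⊗[K] N →ₗ[K] P)
    (h : ∀ t, A.Relator t → f t = 0) : NonabTensor A →ₗ[K] P :=
  A.relations.liftQ f (Submodule.span_le.2 h)

@[simp] theorem descend_mk {P : Type*} [AddCommGroup P] [Module K P] (f : M ⊗[K] N →ₗ[K] P)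
    (h : ∀ t, A.Relator t → f t = 0) (t : M ⊗[K] N) : descend A f h (mk A t) = f t :=
  A.relations.liftQ_apply f t

/-- The linear map `M ⊗ N → M`, `m ⊗ n ↦ ⁿm`. -/
noncomputable def theta : M ⊗[K] N →ₗ[K] M := TensorProduct.lift A.onM.act.flip

/-- The linear map `M ⊗ N → N`, `m ⊗ n ↦ ᵐn`. -/
noncomputable def phi : M ⊗[K] N →ₗ[K] N := TensorProduct.lift A.onN.act

@[simp] theorem theta_tmul (m : M) (n : N) : theta A (m ⊗ₜ n) = A.onM.act n m := rfl

@[simp] theorem phi_tmul (m : M) (n : N) : phi A (m ⊗ₜ n) = A.onN.act m n := rfl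

theorem theta_relator {t : M ⊗[K] N} (h : A.Relator t) : theta A t = 0 := by
  induction h with
  | bracket_left m m' n =>
    simp only [map_add, map_sub, theta_tmul, A.onM.bracket_act, A.compat_M]
    rw [skew K (tw K m') (A.onM.act n m)]
    abel
  | bracket_right m n n' =>
    simp only [map_add, map_sub, theta_tmul, A.onM.act_bracket]
    abel
  | diag m n => simp only [theta_tmul, A.compat_M]; exact bracket_self _
  | swap m m' n n' =>
    simp only [map_add, theta_tmul, A.compat_M]
    rw [skew K (A.onM.act n' m') (A.onM.act n m)]
    abel
  | cyclic m m' m'' n n' n'' =>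
    simp only [map_add, theta_tmul, A.onN.alpha_act, A.compat_M]
    simp only [← A.onM.alpha_act]
    exact jacobi' K _ _ _

theorem phi_relator {t : M ⊗[K] N} (h : A.Relator t) : phi A t = 0 := by
  induction h with
  | bracket_left m m' n =>
    simp only [map_add, map_sub, phi_tmul, A.onN.act_bracket]
    abel
  | bracket_right m n n' =>
    simp only [map_add, map_sub, phi_tmul, A.onN.bracket_act, A.compat_N]
    rw [skew K (tw K n') (A.onN.act m n)]
    abel
  | diag m n => simp only [phi_tmul, A.compat_N]; exact bracket_self _
  | swap m m' n n' =>
    simp only [map_add, phi_tmul, A.compat_N]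
    rw [skew K (A.onN.act m' n') (A.onN.act m n)]
    abel
  | cyclic m m' m'' n n' n'' =>
    simp only [map_add, phi_tmul, A.onN.act_bracket, A.onM.alpha_act, A.compat_N]
    simp only [← A.onN.alpha_act]
    set p := A.onN.act m n
    set q := A.onN.act m' n'
    set r := A.onN.act m'' n''
    have h := jacobi' K p q r
    have e1 : br K (br K r q) (tw K p) = - br K (br K q r) (tw K p) := by
      rw [skew K r q]; simp [br]
    have e2 : br K (br K r p) (tw K q) = - br K (br K p r) (tw K q) := by
      rw [skew K r p]; simp [br]
    have e3 : br K (br K q p) (tw K r) = - br K (br K p q) (tw K r) := by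
      rw [skew K q p]; simp [br]
    rw [e2] at h
    rw [e1, e2, e3]
    have h2 : br K (br K p r) (tw K q) = br K (br K p q) (tw K r) + br K (br K q r) (tw K p) := by
      rw [eq_comm, ← sub_eq_zero, ← h]; abel
    rw [h2]; abel

/-- The bilinear map underlying the bracket, before passing to the quotient:
`(s, t) ↦ -(θ s ⋆ φ t)`, so that `(m ⊗ n, m' ⊗ n') ↦ -(ⁿm ⋆ ᵐ'n')`. -/
noncomputable def preBracket : M ⊗[K] N →ₗ[K] M ⊗[K] N →ₗ[K] NonabTensor A :=
  -(((TensorProduct.mk K M N).compl₁₂ (theta A) (phi A)).compr₂ (mk A))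

theorem preBracket_apply (s t : M ⊗[K] N) :
    preBracket A s t = - mk A (theta A s ⊗ₜ phi A t) := rfl

/-- The bracket of `M ⋆ N`. -/
noncomputable def brk : NonabTensor A →ₗ[K] NonabTensor A →ₗ[K] NonabTensor A :=
  descend A (LinearMap.flip (descend A (preBracket A).flip (by
      intro t ht; ext s; simp [preBracket_apply, phi_relator A ht]))) (by
    intro t ht
    refine LinearMap.ext fun x => ?_
    obtain ⟨s, rfl⟩ := mk_surjective A x
    simp [preBracket_apply, theta_relator A ht])

theorem brk_mk (s t : M ⊗[K] N) :
    brk A (mk A s) (mk A t) = - mk A (theta A s ⊗ₜ phi A t) := by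
  simp [brk, preBracket_apply]

/-- The map `α_M ⊗ α_N` on `M ⊗ N`. -/
noncomputable def preAlpha : M ⊗[K] N →ₗ[K] M ⊗[K] N :=
  TensorProduct.map (alpha (K := K)) (alpha (K := K))

theorem preAlpha_relator {t : M ⊗[K] N} (h : A.Relator t) : A.Relator (preAlpha t) := by
  induction h with
  | bracket_left m m' n =>
    simpa [preAlpha, A.onN.alpha_act, alpha_bracket] using
      CompatibleActions.Relator.bracket_left (A := A) (tw K m) (tw K m') (tw K n)
  | bracket_right m n n' =>
    simpa [preAlpha, A.onM.alpha_act, alpha_bracket] using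
      CompatibleActions.Relator.bracket_right (A := A) (tw K m) (tw K n) (tw K n')
  | diag m n =>
    simpa [preAlpha, A.onM.alpha_act, A.onN.alpha_act] using
      CompatibleActions.Relator.diag (A := A) (tw K m) (tw K n)
  | swap m m' n n' =>
    simpa [preAlpha, A.onM.alpha_act, A.onN.alpha_act] using
      CompatibleActions.Relator.swap (A := A) (tw K m) (tw K m') (tw K n) (tw K n')
  | cyclic m m' m'' n n' n'' =>
    simpa [preAlpha, A.onM.alpha_act, A.onN.alpha_act, alpha_bracket] using
      CompatibleActions.Relator.cyclic (A := A) (tw K m) (tw K m') (tw K m'')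
        (tw K n) (tw K n') (tw K n'')

/-- The endomorphism `α_{M ⋆ N}`, `m ⋆ n ↦ α_M m ⋆ α_N n`. -/
noncomputable def alph : NonabTensor A →ₗ[K] NonabTensor A :=
  descend A ((mk A).comp preAlpha) fun _ ht => mk_relator A (preAlpha_relator A ht)

theorem alph_mk (t : M ⊗[K] N) : alph A (mk A t) = mk A (preAlpha t) := by simp [alph]

theorem theta_preAlpha (t : M ⊗[K] N) : theta A (preAlpha t) = tw K (theta A t) := by
  induction t with
  | zero => simp
  | tmul m n => simp [preAlpha, A.onM.alpha_act]
  | add s t hs ht => simp [hs, ht]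

theorem phi_preAlpha (t : M ⊗[K] N) : phi A (preAlpha t) = tw K (phi A t) := by
  induction t with
  | zero => simp
  | tmul m n => simp [preAlpha, A.onN.alpha_act]
  | add s t hs ht => simp [hs, ht]

theorem swap_mk (s t : M ⊗[K] N) :
    mk A (theta A s ⊗ₜ phi A t) + mk A (theta A t ⊗ₜ phi A s) = 0 := by
  induction s with
  | zero => simp
  | add s s' hs hs' =>
    simp only [map_add, TensorProduct.add_tmul, TensorProduct.tmul_add]
    rw [show ∀ a b c d : NonabTensor A, a + b + (c + d) = (a + c) + (b + d) from
      fun a b c d => by abel, hs, hs', add_zero]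
  | tmul m n =>
    induction t with
    | zero => simp
    | add t t' ht ht' =>
      simp only [map_add, TensorProduct.add_tmul, TensorProduct.tmul_add] at *
      rw [show ∀ a b c d : NonabTensor A, a + b + (c + d) = (a + c) + (b + d) from
        fun a b c d => by abel, ht, ht', add_zero]
    | tmul m' n' =>
      rw [← map_add]
      exact mk_relator A (.swap m m' n n')

theorem diag_mk (s : M ⊗[K] N) : mk A (theta A s ⊗ₜ phi A s) = 0 := by
  induction s with
  | zero => simp
  | tmul m n => exact mk_relator A (.diag m n)
  | add s t hs ht =>
    have h := swap_mk A s t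
    simp only [map_add, TensorProduct.add_tmul, TensorProduct.tmul_add, hs, ht]
    rw [zero_add, add_zero, add_comm]
    exact h

theorem cyclic_mk (s t r : M ⊗[K] N) :
    mk A (br K (theta A s) (theta A t) ⊗ₜ tw K (phi A r))
      + mk A (br K (theta A t) (theta A r) ⊗ₜ tw K (phi A s))
      + mk A (br K (theta A r) (theta A s) ⊗ₜ tw K (phi A t)) = 0 := by
  have key : ∀ a b c d e f : NonabTensor A, a + b + c = 0 → d + e + f = 0 →
      (a + d) + (b + e) + (c + f) = 0 := by
    intro a b c d e f h h'
    rw [show (a + d) + (b + e) + (c + f) = (a + b + c) + (d + e + f) by abel, h, h', add_zero]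
  induction s with
  | zero => simp [br]
  | add s s' hs hs' =>
    simp only [br, tw, map_add, LinearMap.add_apply, TensorProduct.add_tmul,
      TensorProduct.tmul_add] at *
    exact key _ _ _ _ _ _ hs hs'
  | tmul m n =>
    induction t with
    | zero => simp [br]
    | add t t' ht ht' =>
      simp only [br, tw, map_add, LinearMap.add_apply, TensorProduct.add_tmul,
        TensorProduct.tmul_add] at *
      exact key _ _ _ _ _ _ ht ht'
    | tmul m' n' =>
      induction r with
      | zero => simp [br]
      | add r r' hr hr' =>
        simp only [br, tw, map_add, LinearMap.add_apply, TensorProduct.add_tmul,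
          TensorProduct.tmul_add] at *
        exact key _ _ _ _ _ _ hr hr'
      | tmul m'' n'' =>
        rw [← map_add, ← map_add]
        exact mk_relator A (.cyclic m m' m'' n n' n'')

theorem act_phi (t : M ⊗[K] N) (m : M) : A.onM.act (phi A t) m = br K m (theta A t) := by
  induction t with
  | zero => simp [br]
  | tmul m' n' => exact A.compat_M m' m n'
  | add s t hs ht => simp [br, hs, ht]

theorem brk_self (x : NonabTensor A) : brk A x x = 0 := by
  obtain ⟨s, rfl⟩ := mk_surjective A x
  rw [brk_mk, diag_mk, neg_zero]

theorem brk_skew (x y : NonabTensor A) : brk A x y = - brk A y x := by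
  have h := brk_self A (x + y)
  simp only [map_add, LinearMap.add_apply, brk_self, zero_add, add_zero] at h
  exact eq_neg_of_add_eq_zero_right h

theorem brk_brk_alph (r s t : M ⊗[K] N) :
    brk A (brk A (mk A s) (mk A t)) (alph A (mk A r)) =
      mk A (br K (theta A s) (theta A t) ⊗ₜ tw K (phi A r)) := by
  rw [brk_mk, alph_mk, ← map_neg, brk_mk, map_neg, theta_tmul, act_phi, phi_preAlpha]
  simp [TensorProduct.neg_tmul]

/-- The Hom-Lie algebra `M ⋆ N`. -/
noncomputable instance : HomLieAlgebra K (NonabTensor A) where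
  bracket := brk A
  alpha := alph A
  bracket_self := brk_self A
  hom_jacobi x y z := by
    obtain ⟨s, rfl⟩ := mk_surjective A x
    obtain ⟨t, rfl⟩ := mk_surjective A y
    obtain ⟨r, rfl⟩ := mk_surjective A z
    rw [brk_skew A (alph A (mk A s)), brk_skew A (alph A (mk A t)), brk_skew A (alph A (mk A r)),
      brk_brk_alph, brk_brk_alph, brk_brk_alph, ← neg_add, ← neg_add, neg_eq_zero,
      ← cyclic_mk A s t r]
    abel
  alpha_bracket x y := by
    obtain ⟨s, rfl⟩ := mk_surjective A x
    obtain ⟨t, rfl⟩ := mk_surjective A y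
    rw [brk_mk, map_neg, alph_mk, alph_mk, alph_mk, brk_mk, theta_preAlpha, phi_preAlpha]
    rfl

/-- The bracket on generators. -/
theorem br_star (m m' : M) (n n' : N) :
    br K (star A m n) (star A m' n') = - star A (A.onM.act n m) (A.onN.act m' n') :=
  brk_mk A _ _

/-- The endomorphism on generators. -/
theorem tw_star (m : M) (n : N) : tw K (star A m n) = star A (tw K m) (tw K n) :=
  alph_mk A _

/-- The homomorphism `ψ_M : M ⋆ N → M`, `m ⋆ n ↦ -ⁿm`. -/
noncomputable def psi : HomLieHom K (NonabTensor A) M where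
  toLinearMap := descend A (-theta A) fun _ ht => by simp [theta_relator A ht]
  map_bracket' x y := by
    obtain ⟨s, rfl⟩ := mk_surjective A x
    obtain ⟨t, rfl⟩ := mk_surjective A y
    change descend A _ _ (brk A (mk A s) (mk A t)) =
      br K (descend A _ _ (mk A s)) (descend A _ _ (mk A t))
    rw [brk_mk]
    simp [br, act_phi]
  map_alpha' x := by
    obtain ⟨s, rfl⟩ := mk_surjective A x
    change descend A _ _ (alph A (mk A s)) = tw K (descend A _ _ (mk A s))
    rw [alph_mk]
    simp [theta_preAlpha]

theorem psi_star (m : M) (n : N) : psi A (star A m n) = - A.onM.act n m :=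
  descend_mk A (-theta A) (fun _ ht => by simp [theta_relator A ht]) (m ⊗ₜ n)

end NonabTensor

end TensorDef

namespace NonabTensor

section Functoriality

variable {K : Type v} [Field K] {M N M' N' : Type*}
  [AddCommGroup M] [Module K M] [HomLieAlgebra K M]
  [AddCommGroup N] [Module K N] [HomLieAlgebra K N]
  [AddCommGroup M'] [Module K M'] [HomLieAlgebra K M']
  [AddCommGroup N'] [Module K N'] [HomLieAlgebra K N']
  (A : CompatibleActions K M N) (A' : CompatibleActions K M' N')
  (f : HomLieHom K M M') (g : HomLieHom K N N')

/-- The linear map `f ⊗ g`. -/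
noncomputable def preMap : M ⊗[K] N →ₗ[K] M' ⊗[K] N' :=
  TensorProduct.map f.toLinearMap g.toLinearMap

theorem preMap_relator
    (hf : ∀ (n : N) (m : M), f (A.onM.act n m) = A'.onM.act (g n) (f m))
    (hg : ∀ (m : M) (n : N), g (A.onN.act m n) = A'.onN.act (f m) (g n))
    {t : M ⊗[K] N} (h : A.Relator t) : A'.Relator (preMap f g t) := by
  induction h with
  | bracket_left m m' n =>
    simpa [preMap, hg, f.map_br, f.map_tw, g.map_tw] using
      CompatibleActions.Relator.bracket_left (A := A') (f m) (f m') (g n)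
  | bracket_right m n n' =>
    simpa [preMap, hf, g.map_br, f.map_tw, g.map_tw] using
      CompatibleActions.Relator.bracket_right (A := A') (f m) (g n) (g n')
  | diag m n =>
    simpa [preMap, hf, hg] using CompatibleActions.Relator.diag (A := A') (f m) (g n)
  | swap m m' n n' =>
    simpa [preMap, hf, hg] using
      CompatibleActions.Relator.swap (A := A') (f m) (f m') (g n) (g n')
  | cyclic m m' m'' n n' n'' =>
    simpa [preMap, hf, hg, f.map_br, g.map_tw] using
      CompatibleActions.Relator.cyclic (A := A') (f m) (f m') (f m'') (g n) (g n') (g n'')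

theorem theta_preMap
    (hf : ∀ (n : N) (m : M), f (A.onM.act n m) = A'.onM.act (g n) (f m))
    (t : M ⊗[K] N) : theta A' (preMap f g t) = f (theta A t) := by
  induction t with
  | zero => simp
  | tmul m n => simp [preMap, hf]
  | add s t hs ht => simp [hs, ht]

theorem phi_preMap
    (hg : ∀ (m : M) (n : N), g (A.onN.act m n) = A'.onN.act (f m) (g n))
    (t : M ⊗[K] N) : phi A' (preMap f g t) = g (phi A t) := by
  induction t with
  | zero => simp
  | tmul m n => simp [preMap, hg]
  | add s t hs ht => simp [hs, ht]

theorem preMap_preAlpha (t : M ⊗[K] N) : preMap f g (preAlpha t) = preAlpha (preMap f g t) := by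
  induction t with
  | zero => simp
  | tmul m n => simp [preMap, preAlpha, f.map_tw, g.map_tw]
  | add s t hs ht => simp [hs, ht]

/-- The homomorphism `f ⋆ g : M ⋆ N → M' ⋆ N'`, `m ⋆ n ↦ f m ⋆ g n`, for homomorphisms `f` and `g`
that preserve the actions. -/
noncomputable def map
    (hf : ∀ (n : N) (m : M), f (A.onM.act n m) = A'.onM.act (g n) (f m))
    (hg : ∀ (m : M) (n : N), g (A.onN.act m n) = A'.onN.act (f m) (g n)) :
    HomLieHom K (NonabTensor A) (NonabTensor A') where
  toLinearMap := descend A ((mk A').comp (preMap f g)) fun _ ht =>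
    mk_relator A' (preMap_relator A A' f g hf hg ht)
  map_bracket' x y := by
    obtain ⟨s, rfl⟩ := mk_surjective A x
    obtain ⟨t, rfl⟩ := mk_surjective A y
    change descend A _ _ (brk A (mk A s) (mk A t)) =
      brk A' (descend A _ _ (mk A s)) (descend A _ _ (mk A t))
    rw [brk_mk, map_neg, descend_mk, descend_mk, descend_mk]
    simp only [LinearMap.comp_apply, brk_mk, theta_preMap A A' f g hf, phi_preMap A A' f g hg]
    simp [preMap]
  map_alpha' x := by
    obtain ⟨s, rfl⟩ := mk_surjective A x
    change descend A _ _ (alph A (mk A s)) = alph A' (descend A _ _ (mk A s))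
    rw [alph_mk, descend_mk, descend_mk]
    simp only [LinearMap.comp_apply, alph_mk, preMap_preAlpha]

theorem map_star
    (hf : ∀ (n : N) (m : M), f (A.onM.act n m) = A'.onM.act (g n) (f m))
    (hg : ∀ (m : M) (n : N), g (A.onN.act m n) = A'.onN.act (f m) (g n))
    (m : M) (n : N) :
    map A A' f g hf hg (star A m n) = star A' (f m) (g n) :=
  descend_mk A ((mk A').comp (preMap f g)) (fun _ ht =>
    mk_relator A' (preMap_relator A A' f g hf hg ht)) (m ⊗ₜ n)

end Functoriality

end NonabTensor

section Square

/-- `M ⋆ M`, with respect to the actions of `M` on itself by its bracket. -/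
abbrev TensorSquare (K : Type v) [Field K] (M : Type u)
    [AddCommGroup M] [Module K M] [HomLieAlgebra K M] : Type u :=
  NonabTensor (CompatibleActions.adjoint K M)

/-- `ψ_M : M ⋆ M → M`, `m ⋆ m' ↦ [m, m']`. -/
noncomputable def TensorSquare.psi (K : Type v) [Field K] (M : Type u)
    [AddCommGroup M] [Module K M] [HomLieAlgebra K M] : HomLieHom K (TensorSquare K M) M :=
  NonabTensor.psi (CompatibleActions.adjoint K M)

theorem TensorSquare.psi_star (K : Type v) [Field K] (M : Type u)
    [AddCommGroup M] [Module K M] [HomLieAlgebra K M] (m m' : M) :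
    TensorSquare.psi K M (NonabTensor.star _ m m') = br K m m' := by
  refine (NonabTensor.psi_star _ m m').trans ?_
  exact (skew K m m').symm

/-- `f ⋆ f : M ⋆ M → M' ⋆ M'`. -/
noncomputable def TensorSquare.map {K : Type v} [Field K] {M : Type u} {M' : Type w}
    [AddCommGroup M] [Module K M] [HomLieAlgebra K M]
    [AddCommGroup M'] [Module K M'] [HomLieAlgebra K M'] (f : HomLieHom K M M') :
    HomLieHom K (TensorSquare K M) (TensorSquare K M') :=
  NonabTensor.map _ _ f f (fun n m => f.map_br n m) (fun m n => f.map_br m n)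

end Square

/-! ### Homomorphisms and central extensions -/

namespace HomLieHom

variable {K : Type*} [Field K] {E E' L L' L'' : Type*}
  [AddCommGroup E] [Module K E] [HomLieAlgebra K E]
  [AddCommGroup E'] [Module K E'] [HomLieAlgebra K E']
  [AddCommGroup L] [Module K L] [HomLieAlgebra K L]
  [AddCommGroup L'] [Module K L'] [HomLieAlgebra K L']
  [AddCommGroup L''] [Module K L''] [HomLieAlgebra K L'']

/-! Everything rests on two facts about brackets. First, in `M ⋆ M` the bracket factors through
`ψ_M`: `[x, y] = ψ_M(x) ⋆ ψ_M(y)` (`br_eq`). Hence `Ker ψ_M` is central, and if `M` is perfect, so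
that `ψ_M` is onto, every generator `m ⋆ n` is itself a bracket and `M ⋆ M` is perfect. Second, in a
central extension `π : E → M` the bracket of two elements depends only on their images in `M`
(`IsCentralExtension.br_congr`). So `m ⋆ n ↦ [lift of m, lift of n]` is unambiguous, and the
relators of `M ⋆ M` go to consequences of alternation and the Hom-Jacobi identity in `E`
(`bracketLift_relator`). This gives a homomorphism `M ⋆ M → E` over `M`, unique because `M ⋆ M` is
perfect (`IsCentralExtension.hom_ext`). Thus `ψ_M` is universal for every perfect `M`, in particular
for `G` and for `G ⋆ G`.

For `ω`, compare the given extensions with these models: there are surjections `h : G ⋆ G → uce(G)`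
over `G` and `g : uce(G ⋆ G) → (G ⋆ G) ⋆ (G ⋆ G)` over `G ⋆ G`. Take `ω = (h ⋆ h) ∘ g`. Since `p ∘ h
= ψ_G`, the triangle reduces to `ψ_G ⋆ ψ_G = ψ_{G ⋆ G}` (`map_psi`), which is the first fact again.
-/

theorem toLinearMap_injective :
    Function.Injective (HomLieHom.toLinearMap : HomLieHom K L L' → L →ₗ[K] L') := by
  rintro ⟨f, _, _⟩ ⟨g, _, _⟩ h
  congr

theorem ext_apply {f g : HomLieHom K L L'} (h : ∀ x, f x = g x) : f = g :=
  toLinearMap_injective (LinearMap.ext h)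

/-- The identity homomorphism. -/
def id (K : Type*) [Field K] (L : Type*) [AddCommGroup L] [Module K L] [HomLieAlgebra K L] :
    HomLieHom K L L where
  toLinearMap := LinearMap.id
  map_bracket' _ _ := rfl
  map_alpha' _ := rfl

/-- The composition of homomorphisms. -/
def comp (g : HomLieHom K L' L'') (f : HomLieHom K L L') : HomLieHom K L L'' where
  toLinearMap := g.toLinearMap.comp f.toLinearMap
  map_bracket' x y := (congrArg g (f.map_br x y)).trans (g.map_br _ _)
  map_alpha' x := (congrArg g (f.map_tw x)).trans (g.map_tw _)

/-- In a central extension the bracket depends only on the images in the base. -/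
theorem IsCentralExtension.br_congr {π : HomLieHom K E L} (hπ : IsCentralExtension π)
    {a a' b b' : E} (ha : π a = π a') (hb : π b = π b') : br K a b = br K a' b' := by
  -- Change one argument at a time. Centrality kills kernel elements on the left only, so the second
  -- argument is handled through skew-symmetry.
  have h₁ : br K (a - a') b = 0 := hπ.2 _ (by rw [map_sub, ha, sub_self]) b
  have h₂ : br K (b - b') a' = 0 := hπ.2 _ (by rw [map_sub, hb, sub_self]) a'
  rw [skew K, neg_eq_zero] at h₂
  simp only [br, map_sub, LinearMap.sub_apply, sub_eq_zero] at h₁ h₂ ⊢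
  exact h₁.trans h₂

/-- Homomorphisms from a perfect Hom-Lie algebra to a central extension are determined by their
projections to the base. -/
theorem IsCentralExtension.hom_ext {π : HomLieHom K E L} (hπ : IsCentralExtension π)
    (hL' : IsPerfect K L') {f g : HomLieHom K L' E} (h : ∀ x, π (f x) = π (g x)) : f = g := by
  apply toLinearMap_injective
  refine LinearMap.ext_on_range (v := fun x : {z : L' | ∃ x y : L', z = br K x y} => x.1)
    (by rw [Subtype.range_coe]; exact hL') ?_
  rintro ⟨_, x, y, rfl⟩
  change f (br K x y) = g (br K x y)
  rw [f.map_br, g.map_br]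
  exact hπ.br_congr (h x) (h y)

/-- The homomorphism between two universal central extensions of the same algebra is surjective. -/
theorem IsUniversalCentralExtension.surjective_hom.{a} {E E' : Type a}
    [AddCommGroup E] [Module K E] [HomLieAlgebra K E]
    [AddCommGroup E'] [Module K E'] [HomLieAlgebra K E']
    {π : HomLieHom K E L} {π' : HomLieHom K E' L}
    (hπ : IsUniversalCentralExtension.{a} π) (hπ' : IsUniversalCentralExtension.{a} π')
    (h : HomLieHom K E E') (hh : ∀ x, π' (h x) = π x) : Function.Surjective h := by
  obtain ⟨k, hk, -⟩ := hπ'.2 E π hπ.1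
  -- Both sides are endomorphisms of `E'` over `L`, so universality of `π'`, tested on `π'` itself,
  -- identifies them; `k` is then a section of `h`.
  have hid : h.comp k = HomLieHom.id K E' :=
    (hπ'.2 E' π' hπ'.1).unique (fun x => (hh (k x)).trans (hk x)) fun _ => rfl
  exact fun x => ⟨k x, congrArg (fun f : HomLieHom K E' E' => f x) hid⟩

end HomLieHom

/-! ### The tensor square as a perfect central extension -/

namespace TensorSquare

open HomLieHom NonabTensor

variable {K : Type*} [Field K] {M M' E : Type*}
  [AddCommGroup M] [Module K M] [HomLieAlgebra K M]
  [AddCommGroup M'] [Module K M'] [HomLieAlgebra K M']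
  [AddCommGroup E] [Module K E] [HomLieAlgebra K E]

/-- The class `m ⋆ n` in `M ⋆ M`. -/
noncomputable abbrev tmul (K : Type*) [Field K] {M : Type*}
    [AddCommGroup M] [Module K M] [HomLieAlgebra K M] (m n : M) : TensorSquare K M :=
  star (CompatibleActions.adjoint K M) m n

theorem hom_linear_ext {P : Type*} [AddCommGroup P] [Module K P] {f g : TensorSquare K M →ₗ[K] P}
    (h : ∀ m n : M, f (tmul K m n) = g (tmul K m n)) : f = g := by
  refine LinearMap.ext fun x => ?_
  obtain ⟨t, rfl⟩ := mk_surjective _ x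
  induction t with
  | zero => simp
  | tmul m n => exact h m n
  | add s t hs ht => simp only [map_add, hs, ht]

/-- The sign in the definition of the bracket is absorbed by reversing `[n, m]`; in this form both
factors are values of `ψ_M`. -/
theorem br_tmul (m n m' n' : M) :
    br K (tmul K m n) (tmul K m' n') = tmul K (br K m n) (br K m' n') := by
  refine (br_star _ m m' n n').trans ?_
  change - NonabTensor.mk _ (br K n m ⊗ₜ br K m' n') = NonabTensor.mk _ (br K m n ⊗ₜ br K m' n')
  rw [skew K n m, TensorProduct.neg_tmul, map_neg, neg_neg]

theorem map_tmul (f : HomLieHom K M M') (m n : M) :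
    TensorSquare.map f (tmul K m n) = tmul K (f m) (f n) :=
  map_star _ _ _ _ _ _ _ _

theorem map_surjective {f : HomLieHom K M M'} (hf : Function.Surjective f) :
    Function.Surjective (TensorSquare.map f) := by
  intro x
  obtain ⟨t, rfl⟩ := mk_surjective _ x
  obtain ⟨s, rfl⟩ := TensorProduct.map_surjective hf hf t
  exact ⟨NonabTensor.mk _ s, rfl⟩

theorem psi_surjective (hM : IsPerfect K M) : Function.Surjective (TensorSquare.psi K M) := by
  -- The range is a subspace, so it suffices that it contains the brackets, which span `M`.
  refine LinearMap.range_eq_top.1 (top_le_iff.1 (hM.symm.le.trans (Submodule.span_le.2 ?_)))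
  rintro _ ⟨x, y, rfl⟩
  exact ⟨_, TensorSquare.psi_star K M x y⟩

/-- The bracket of `M ⋆ M` factors through `ψ_M`. -/
theorem br_eq (x y : TensorSquare K M) :
    br K x y = tmul K (TensorSquare.psi K M x) (TensorSquare.psi K M y) := by
  have h : bracket (K := K) (L := TensorSquare K M) =
      ((TensorProduct.mk K M M).compl₁₂ (TensorSquare.psi K M).toLinearMap
        (TensorSquare.psi K M).toLinearMap).compr₂ (mk (CompatibleActions.adjoint K M)) := by
    refine hom_linear_ext fun m n => hom_linear_ext fun m' n' => ?_
    refine (br_tmul m n m' n').trans ?_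
    change _ = tmul K (TensorSquare.psi K M (tmul K m n)) (TensorSquare.psi K M (tmul K m' n'))
    rw [TensorSquare.psi_star, TensorSquare.psi_star]
  exact congrArg (fun b => b x y) h

/-- Perfectness is needed only for surjectivity. Centrality follows from `br_eq`: if `ψ_M(x) = 0`,
then `[x, y] = 0 ⋆ ψ_M(y) = 0`. -/
theorem psi_isCentralExtension (hM : IsPerfect K M) :
    IsCentralExtension (TensorSquare.psi K M) := by
  refine ⟨psi_surjective hM, fun x hx y => ?_⟩
  rw [br_eq, hx]
  change NonabTensor.mk _ ((0 : M) ⊗ₜ _) = 0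
  rw [TensorProduct.zero_tmul, map_zero]

/-- Since `ψ_M` is onto, each generator has the form `ψ_M(x) ⋆ ψ_M(y)`, which is the single bracket
`[x, y]`. -/
theorem isPerfect (hM : IsPerfect K M) : IsPerfect K (TensorSquare K M) := by
  refine top_le_iff.1 fun x _ => ?_
  obtain ⟨t, rfl⟩ := mk_surjective _ x
  induction t with
  | zero => rw [map_zero]; exact zero_mem _
  | tmul m n =>
    obtain ⟨x, rfl⟩ := psi_surjective hM m
    obtain ⟨y, rfl⟩ := psi_surjective hM n
    exact Submodule.subset_span ⟨x, y, (br_eq x y).symm⟩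
  | add s t hs ht => rw [map_add]; exact add_mem (hs trivial) (ht trivial)

/-- `ψ_{M ⋆ M} = ψ_M ⋆ ψ_M`. -/
theorem map_psi (x : TensorSquare K (TensorSquare K M)) :
    TensorSquare.map (TensorSquare.psi K M) x = TensorSquare.psi K (TensorSquare K M) x := by
  have h : (TensorSquare.map (TensorSquare.psi K M)).toLinearMap =
      (TensorSquare.psi K (TensorSquare K M)).toLinearMap :=
    -- On `x ⋆ y` one side is `ψ_M(x) ⋆ ψ_M(y)` and the other is `[x, y]`; these agree by `br_eq`.
    hom_linear_ext fun x y => (map_tmul _ x y).trans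
      ((br_eq x y).symm.trans (TensorSquare.psi_star K _ x y).symm)
  exact congrArg (fun f => f x) h

theorem map_map {M'' : Type*} [AddCommGroup M''] [Module K M''] [HomLieAlgebra K M'']
    (g : HomLieHom K M' M'') (f : HomLieHom K M M') (x : TensorSquare K M) :
    TensorSquare.map g (TensorSquare.map f x) = TensorSquare.map (g.comp f) x := by
  have h : ((TensorSquare.map g).comp (TensorSquare.map f)).toLinearMap =
      (TensorSquare.map (g.comp f)).toLinearMap := by
    refine hom_linear_ext fun m n => ?_
    change TensorSquare.map g (TensorSquare.map f (tmul K m n)) = _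
    rw [map_tmul, map_tmul, map_tmul]
    rfl
  exact congrArg (fun k => k x) h

/-! ### Universality of the tensor square -/

/-- A linear section of `π : E → M` yields a linear map `M ⊗ M → E` by taking brackets of
lifts. -/
noncomputable def bracketLift (σ : M →ₗ[K] E) : M ⊗[K] M →ₗ[K] E :=
  TensorProduct.lift ((bracket (K := K) (L := E)).compl₁₂ σ σ)

/-- Centrality makes the choice of section irrelevant: any lifts may be used in place of those given
by `σ`. -/
theorem bracketLift_tmul {π : HomLieHom K E M} (hπ : IsCentralExtension π) {σ : M →ₗ[K] E}
    (hσ : ∀ m, π (σ m) = m) (a b : E) : bracketLift σ (π a ⊗ₜ π b) = br K a b :=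
  hπ.br_congr (hσ _) (hσ _)

/-- After lifting all entries to `E`, each relator becomes an identity between brackets there: the
first two and the cyclic one are forms of Hom-Jacobi, the diagonal one is alternation, and the swap
one is skew-symmetry. -/
theorem bracketLift_relator {π : HomLieHom K E M} (hπ : IsCentralExtension π) {σ : M →ₗ[K] E}
    (hσ : ∀ m, π (σ m) = m) {t : M ⊗[K] M} (h : (CompatibleActions.adjoint K M).Relator t) :
    bracketLift σ t = 0 := by
  have key := bracketLift_tmul hπ hσ
  induction h with
  | bracket_left m m' n =>
    obtain ⟨a, rfl⟩ := hπ.1 m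
    obtain ⟨b, rfl⟩ := hπ.1 m'
    obtain ⟨c, rfl⟩ := hπ.1 n
    change bracketLift σ (br K (π a) (π b) ⊗ₜ tw K (π c) - tw K (π a) ⊗ₜ br K (π b) (π c)
      + tw K (π b) ⊗ₜ br K (π a) (π c)) = 0
    simp only [← π.map_br, ← π.map_tw, map_add, map_sub, key]
    have h := (HomAction.adjoint K E).act_bracket a b c
    change br K (br K a b) (tw K c) = br K (tw K a) (br K b c) - br K (tw K b) (br K a c) at h
    rw [h]; abel
  | bracket_right m n n' =>
    obtain ⟨a, rfl⟩ := hπ.1 m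
    obtain ⟨b, rfl⟩ := hπ.1 n
    obtain ⟨c, rfl⟩ := hπ.1 n'
    change bracketLift σ (tw K (π a) ⊗ₜ br K (π b) (π c) - br K (π c) (π a) ⊗ₜ tw K (π b)
      + br K (π b) (π a) ⊗ₜ tw K (π c)) = 0
    simp only [← π.map_br, ← π.map_tw, map_add, map_sub, key]
    rw [skew K (br K c a), skew K (br K b a), skew K b a]
    simp only [br, map_neg, neg_neg, sub_neg_eq_add]
    rw [← hom_jacobi (K := K) a b c]; abel
  | diag m n =>
    obtain ⟨a, rfl⟩ := hπ.1 m
    obtain ⟨b, rfl⟩ := hπ.1 n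
    change bracketLift σ (br K (π b) (π a) ⊗ₜ br K (π a) (π b)) = 0
    simp only [← π.map_br, key]
    rw [skew K b a]
    simp [br, bracket_self]
  | swap m m' n n' =>
    obtain ⟨a, rfl⟩ := hπ.1 m
    obtain ⟨a', rfl⟩ := hπ.1 m'
    obtain ⟨b, rfl⟩ := hπ.1 n
    obtain ⟨b', rfl⟩ := hπ.1 n'
    change bracketLift σ (br K (π b) (π a) ⊗ₜ br K (π a') (π b')
      + br K (π b') (π a') ⊗ₜ br K (π a) (π b)) = 0
    simp only [← π.map_br, map_add, key]
    rw [skew K b a, skew K b' a', skew K (-br K a' b')]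
    simp [br]
  | cyclic m m' m'' n n' n'' =>
    obtain ⟨a, rfl⟩ := hπ.1 m
    obtain ⟨a', rfl⟩ := hπ.1 m'
    obtain ⟨a'', rfl⟩ := hπ.1 m''
    obtain ⟨b, rfl⟩ := hπ.1 n
    obtain ⟨b', rfl⟩ := hπ.1 n'
    obtain ⟨b'', rfl⟩ := hπ.1 n''
    change bracketLift σ
      (br K (br K (π b) (π a)) (br K (π b') (π a')) ⊗ₜ tw K (br K (π a'') (π b''))
      + br K (br K (π b') (π a')) (br K (π b'') (π a'')) ⊗ₜ tw K (br K (π a) (π b))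
      + br K (br K (π b'') (π a'')) (br K (π b) (π a)) ⊗ₜ tw K (br K (π a') (π b'))) = 0
    simp only [← π.map_br, ← π.map_tw, map_add, key]
    rw [skew K b a, skew K b' a', skew K b'' a'']
    simpa [br] using jacobi' K (br K a b) (br K a' b') (br K a'' b'')

/-- The homomorphism from `M ⋆ M` to a central extension of `M` sending `m ⋆ n` to the bracket of
lifts of `m` and `n`. -/
theorem exists_hom {π : HomLieHom K E M} (hπ : IsCentralExtension π) :
    ∃ h : HomLieHom K (TensorSquare K M) E, ∀ x, π (h x) = TensorSquare.psi K M x := by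
  -- Over a field a linear section exists. It need not respect brackets or `α`.
  obtain ⟨σ, hσ'⟩ :=
    π.toLinearMap.exists_rightInverse_of_surjective (LinearMap.range_eq_top.2 hπ.1)
  have hσ : ∀ m, π (σ m) = m := fun m => congrArg (fun f => f m) hσ'
  let f : TensorSquare K M →ₗ[K] E :=
    descend _ (bracketLift σ) fun _ ht => bracketLift_relator hπ hσ ht
  have hf : ∀ a b : E, f (tmul K (π a) (π b)) = br K a b := fun a b =>
    (descend_mk _ _ _ _).trans (bracketLift_tmul hπ hσ a b)
  have hψ : ∀ x, π (f x) = TensorSquare.psi K M x := by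
    have h : π.toLinearMap.comp f = (TensorSquare.psi K M).toLinearMap := by
      refine hom_linear_ext fun m n => ?_
      obtain ⟨a, rfl⟩ := hπ.1 m
      obtain ⟨b, rfl⟩ := hπ.1 n
      rw [LinearMap.comp_apply, hf, TensorSquare.psi_star, π.map_br]
    exact fun x => congrArg (fun k => k x) h
  refine ⟨⟨f, fun x y => ?_, fun x => ?_⟩, hψ⟩
  · change f (br K x y) = br K (f x) (f y)
    -- Here `[x, y] = ψ(x) ⋆ ψ(y) = π(f x) ⋆ π(f y)`, and `f x`, `f y` serve as the lifts.
    rw [br_eq, ← hψ, ← hψ, hf]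
  · have h : f.comp alpha = (alpha (K := K)).comp f := by
      refine hom_linear_ext fun m n => ?_
      obtain ⟨a, rfl⟩ := hπ.1 m
      obtain ⟨b, rfl⟩ := hπ.1 n
      change f (tw K (tmul K (π a) (π b))) = tw K (f (tmul K (π a) (π b)))
      -- `α(a)` and `α(b)` are lifts of `α(π a)` and `α(π b)`.
      rw [tw_star, hf, ← π.map_tw, ← π.map_tw, hf]
      exact (alpha_bracket a b).symm
    exact congrArg (fun k => k x) h

theorem psi_isUniversalCentralExtension.{w'} (hM : IsPerfect K M) :
    IsUniversalCentralExtension.{w'} (TensorSquare.psi K M) := by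
  refine ⟨psi_isCentralExtension hM, fun E' _ _ _ π' hπ' => ?_⟩
  obtain ⟨h, hh⟩ := exists_hom hπ'
  exact ⟨h, hh, fun k hk =>
    hπ'.hom_ext (isPerfect hM) fun x => (hk x).trans (hh x).symm⟩

end TensorSquare

/-! ### The main theorem -/

theorem theorem6p6 {K : Type v} [Field K] {G : Type u} [AddCommGroup G] [Module K G]
    [HomLieAlgebra K G] (hG : IsPerfect K G)
    (hα : Function.Surjective (tw K : G → G)) :
    -- `G ⋆ G` and `(G ⋆ G) ⋆ (G ⋆ G)` are the universal central extensions of `G` and of `G ⋆ G`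
    HomLieHom.IsUniversalCentralExtension.{w} (TensorSquare.psi K G) ∧
    HomLieHom.IsUniversalCentralExtension.{w} (TensorSquare.psi K (TensorSquare K G)) ∧
    -- and, for every choice `V` of `uce(G)` and `U` of `uce(G ⋆ G)`, `U` maps onto `V ⋆ V`
    ∀ (V : Type u) [AddCommGroup V] [Module K V] [HomLieAlgebra K V] (p : HomLieHom K V G)
      (U : Type u) [AddCommGroup U] [Module K U] [HomLieAlgebra K U]
      (q : HomLieHom K U (TensorSquare K G)),
      HomLieHom.IsUniversalCentralExtension.{u} p →
      HomLieHom.IsUniversalCentralExtension.{u} q →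
      ∃ ω : HomLieHom K U (TensorSquare K V),
        Function.Surjective ω ∧ ∀ x : U, TensorSquare.map p (ω x) = q x := by
  have hGG := TensorSquare.isPerfect hG
  refine ⟨TensorSquare.psi_isUniversalCentralExtension hG,
    TensorSquare.psi_isUniversalCentralExtension hGG, ?_⟩
  intro V _ _ _ p U _ _ _ q hp hq
  have hψ := TensorSquare.psi_isUniversalCentralExtension.{v, u, u} hG
  have hψ₂ := TensorSquare.psi_isUniversalCentralExtension.{v, u, u} hGG
  obtain ⟨h, hh, -⟩ := hψ.2 V p hp.1
  obtain ⟨g, hg, -⟩ := hq.2 _ _ hψ₂.1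
  -- Both `h` and `g` are surjective as comparison maps between universal central extensions of the
  -- same algebra, and `h ⋆ h` inherits surjectivity from `h`.
  refine ⟨(TensorSquare.map h).comp g,
    (TensorSquare.map_surjective (hψ.surjective_hom hp h hh)).comp (hq.surjective_hom hψ₂ g hg),
    fun x => ?_⟩
  have hph : p.comp h = TensorSquare.psi K G := HomLieHom.ext_apply hh
  calc TensorSquare.map p (TensorSquare.map h (g x))
      = TensorSquare.map (TensorSquare.psi K G) (g x) := by rw [TensorSquare.map_map, hph]
    _ = q x := (TensorSquare.map_psi _).trans (hg x)
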